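/- **Proposition.** Let $X$ and $Y$ be separated (Hausdorff) locally convex topological vector spaces over the same field $\mathbb{K}\in\{\mathbb{R},\mathbb{C}\}$, and assume that $Y$ is fully complete (a Ptak space): a vector subspace $M$ of the continuous dual $Y'$ is weak-$*$ closed whenever $M\cap U^\circ$ is weak-$*$ closed for every neighbourhood $U$ of zero in $Y$, where $U^\circ=\{f\in Y' : |f(y)|\le 1 \text{ for all } y\in U\}$. Let $\Gamma\subseteq X\times Y$ be a closed linear subspace with domain $X$, that is, for every $x\in X$ there is $y\in Y$ with $(x,y)\in\Gamma$. For $B\subseteq Y$ write $$\Gamma B=\{x\in X : (x,b)\in\Gamma \text{ for some } b\in B\}.$$ If $\overline{\Gamma B}$ is a neighbourhood of zero in $X$ for every (not necessarily open) neighbourhood $B$ of zero in $Y$, then $\Gamma B$ is open in $X$ for every open $B\subseteq Y$. -/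

import Mathlib

open scoped Topology

/-- A separated locally convex space `E` over `𝕜` (real or complex) is *fully complete* (a Ptak
space, or `B`-complete space) if a vector subspace `M` of its continuous dual is weak-* closed
as soon as `M ∩ U°` is weak-* closed for every neighbourhood `U` of zero in `E`. Here
`U° = {f | ∀ x ∈ U, ‖f x‖ ≤ 1}` is the absolute polar, and `WeakDual 𝕜 E` is the continuous dual
with the topology of pointwise convergence on `E`. -/
structure IsFullyComplete (𝕜 E : Type*) [RCLike 𝕜] [AddCommGroup E] [Module 𝕜 E] [Module ℝ E]
    [TopologicalSpace E] : Prop where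
  separated : T2Space E
  locallyConvex : LocallyConvexSpace ℝ E
  isClosed_of_inter_polar : ∀ M : Submodule 𝕜 (WeakDual 𝕜 E),
    (∀ U ∈ 𝓝 (0 : E), IsClosed ((M : Set (WeakDual 𝕜 E)) ∩ WeakDual.polar 𝕜 U)) →
      IsClosed (M : Set (WeakDual 𝕜 E))

/-! The proof is by duality, through the domain `D` of the adjoint of `Γ`. Near continuity and
Banach–Alaoglu present each `D ∩ U°` as the projection of a weak-* compact set, so full completeness
makes `D` weak-* closed. As `Γ` is closed, Hahn–Banach in `X × Y` puts the pre-annihilator of `D`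
inside `Γ 0 = {y | (0, y) ∈ Γ}`; hence `D` contains every functional vanishing on `Γ 0`.

This removes the closure in the hypothesis (`Submodule.preimage_mem_nhds_zero`). Let `x` be in the
closure of the preimage of a convex `W`, and `(x, y) ∈ Γ`. A functional separating `y` from the
closure of `Γ 0 + W` would vanish on `Γ 0`, so lie in `D`; its partner on `X` carries the bound on
`W` over to `x`, a contradiction. So `y ∈ Γ 0 + W - W`, and `x` lies in the preimage of `W - W`.
Translation then gives openness. -/

namespace WeakDual

/-- The polar of a neighbourhood of zero consists exactly of the linear functionals bounded by
`1` on it. -/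
theorem coe_image_polar_of_mem_nhds {𝕜 E : Type*} [RCLike 𝕜] [AddCommGroup E] [Module 𝕜 E]
    [TopologicalSpace E] [IsTopologicalAddGroup E] [ContinuousSMul 𝕜 E] {U : Set E}
    (hU : U ∈ 𝓝 (0 : E)) :
    (fun (f : WeakDual 𝕜 E) (x : E) => f x) '' polar 𝕜 U =
      Set.range (fun (f : E →ₗ[𝕜] 𝕜) (x : E) => f x) ∩ ⋂ x ∈ U, {φ | ‖φ x‖ ≤ 1} := by
  ext φ
  constructor
  · rintro ⟨f, hf, rfl⟩
    exact ⟨⟨(toStrongDual f).toLinearMap, rfl⟩, Set.mem_iInter₂.2 hf⟩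
  · rintro ⟨⟨f, rfl⟩, hf⟩
    have hf' : ∀ x ∈ U, ‖f x‖ ≤ 1 := by simpa using hf
    have hbdd : Bornology.IsVonNBounded 𝕜 (f '' U) := by
      rw [NormedSpace.isVonNBounded_iff, isBounded_iff_forall_norm_le]
      exact ⟨1, Set.forall_mem_image.2 hf'⟩
    exact ⟨StrongDual.toWeakDual (f.clmOfExistsBoundedImage ⟨U, hU, hbdd⟩), hf', rfl⟩

/-- The functionals in the polar of a neighbourhood of zero are uniformly bounded at each point. -/
theorem exists_norm_apply_le_of_mem_polar {𝕜 E : Type*} [RCLike 𝕜] [AddCommGroup E] [Module 𝕜 E]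
    [TopologicalSpace E] [ContinuousSMul 𝕜 E] {U : Set E} (hU : U ∈ 𝓝 (0 : E)) (x : E) :
    ∃ r : ℝ, ∀ f ∈ polar 𝕜 U, ‖f x‖ ≤ r := by
  obtain ⟨r, hr, hx⟩ := (absorbent_nhds_zero (𝕜 := 𝕜) hU x).exists_pos
  have hnorm : ‖(r : 𝕜)‖ = r := by simp [abs_of_pos hr]
  obtain ⟨u, hu, rfl⟩ := hx (r : 𝕜) hnorm.ge (Set.mem_singleton x)
  refine ⟨r, fun f hf => ?_⟩
  have hfu : f ((r : 𝕜) • u) = (r : 𝕜) * f u := map_smul f _ _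
  have hfu_le : ‖f u‖ ≤ 1 := hf u hu
  change ‖f ((r : 𝕜) • u)‖ ≤ r
  rw [hfu, norm_mul, hnorm]
  exact mul_le_of_le_one_right hr.le hfu_le

/-- The **Banach–Alaoglu theorem** for topological vector spaces: the polar of a neighbourhood of
zero is weak-* compact. -/
theorem isCompact_polar_of_mem_nhds {𝕜 E : Type*} [RCLike 𝕜] [AddCommGroup E] [Module 𝕜 E]
    [TopologicalSpace E] [IsTopologicalAddGroup E] [ContinuousSMul 𝕜 E] {U : Set E}
    (hU : U ∈ 𝓝 (0 : E)) : IsCompact (polar 𝕜 U) := by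
  have hind : Topology.IsInducing (fun (f : WeakDual 𝕜 E) (x : E) => f x) :=
    (WeakBilin.isEmbedding (B := topDualPairing 𝕜 E) ContinuousLinearMap.coe_injective).isInducing
  rw [hind.isCompact_iff]
  choose r hr using exists_norm_apply_le_of_mem_polar (𝕜 := 𝕜) hU
  have hcompact : IsCompact (Set.univ.pi fun x : E => Metric.closedBall (0 : 𝕜) (r x)) :=
    isCompact_univ_pi fun x => ProperSpace.isCompact_closedBall 0 (r x)
  have hclosed : IsClosed ((fun (f : WeakDual 𝕜 E) (x : E) => f x) '' polar 𝕜 U) := by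
    rw [coe_image_polar_of_mem_nhds hU]
    exact (LinearMap.isClosed_range_coe E 𝕜 (RingHom.id 𝕜)).inter
      (isClosed_biInter fun x _ => isClosed_le (continuous_apply x).norm continuous_const)
  refine hcompact.of_isClosed_subset hclosed ?_
  rintro _ ⟨f, hf, rfl⟩ x -
  exact mem_closedBall_zero_iff.2 (hr x f hf)

/-- The weak-* topology is locally convex. -/
theorem locallyConvexSpace_real {𝕜 E : Type*} [RCLike 𝕜] [AddCommGroup E] [Module 𝕜 E]
    [TopologicalSpace E] [IsTopologicalAddGroup E] : LocallyConvexSpace ℝ (WeakDual 𝕜 E) :=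
  LocallyConvexSpace.induced (𝕜 := ℝ) (F := E → 𝕜)
    ({ toFun := fun f x => f x, map_add' := fun _ _ => rfl, map_smul' := fun _ _ => rfl } :
      WeakDual 𝕜 E →ₗ[ℝ] (E → 𝕜))

end WeakDual

/-- A functional whose real part is bounded above on a subspace vanishes on it. -/
theorem Submodule.apply_eq_zero_of_re_lt {𝕜 E : Type*} [RCLike 𝕜] [AddCommGroup E] [Module 𝕜 E]
    (S : Submodule 𝕜 E) (f : E →ₗ[𝕜] 𝕜) {u : ℝ} (hf : ∀ a ∈ S, RCLike.re (f a) < u)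
    {a : E} (ha : a ∈ S) : f a = 0 := by
  by_contra h
  -- The scaling makes the value of `f` exactly `u`, so the bound reads `u < u`.
  have := hf (((u : 𝕜) / f a) • a) (S.smul_mem _ ha)
  simp [div_mul_cancel₀ _ h] at this

/-- A point outside a closed subspace of a locally convex space is separated from it by a
continuous functional vanishing on the subspace. -/
theorem Submodule.exists_strongDual_ne_zero {𝕜 E : Type*} [RCLike 𝕜] [AddCommGroup E]
    [Module 𝕜 E] [Module ℝ E] [IsScalarTower ℝ 𝕜 E] [TopologicalSpace E]
    [IsTopologicalAddGroup E] [ContinuousSMul 𝕜 E] [LocallyConvexSpace ℝ E]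
    (S : Submodule 𝕜 E) (hS : IsClosed (S : Set E)) {x : E} (hx : x ∉ S) :
    ∃ f : StrongDual 𝕜 E, (∀ a ∈ S, f a = 0) ∧ f x ≠ 0 := by
  obtain ⟨f, u, hf, hfx⟩ := RCLike.geometric_hahn_banach_closed_point (𝕜 := 𝕜)
    (S.restrictScalars ℝ).convex hS hx
  refine ⟨f, fun a ha => S.apply_eq_zero_of_re_lt f.toLinearMap hf ha, fun h => ?_⟩
  have := hf 0 S.zero_mem
  simp only [map_zero, h] at this hfx
  exact lt_asymm this hfx

/-- A weak-* closed subspace of the dual contains every functional that vanishes on its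
pre-annihilator. -/
theorem WeakDual.mem_of_isClosed_of_forall_eq_zero {𝕜 E : Type*} [RCLike 𝕜] [AddCommGroup E]
    [Module 𝕜 E] [TopologicalSpace E] [IsTopologicalAddGroup E]
    (D : Submodule 𝕜 (WeakDual 𝕜 E)) (hD : IsClosed (D : Set (WeakDual 𝕜 E)))
    {g : WeakDual 𝕜 E} (hg : ∀ y : E, (∀ d ∈ D, d y = 0) → g y = 0) : g ∈ D := by
  by_contra h
  have := WeakDual.locallyConvexSpace_real (𝕜 := 𝕜) (E := E)
  obtain ⟨F, hF, hFg⟩ := D.exists_strongDual_ne_zero hD h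
  -- A weak-* continuous functional on the dual is evaluation at a point `y`.
  obtain ⟨y, rfl⟩ := LinearMap.dualEmbedding_surjective (topDualPairing 𝕜 E) F
  exact hFg (hg y hF)

section LinearRelation

variable {𝕜 X Y : Type*} [RCLike 𝕜]
  [AddCommGroup X] [Module 𝕜 X] [TopologicalSpace X]
  [AddCommGroup Y] [Module 𝕜 Y] [TopologicalSpace Y] [IsTopologicalAddGroup Y]

/-- A linear relation that pulls neighbourhoods of zero back to neighbourhoods of zero pulls open
sets back to open sets. -/
theorem Submodule.isOpen_preimage [IsTopologicalAddGroup X] (Γ : Submodule 𝕜 (X × Y))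
    (hΓ : ∀ B ∈ 𝓝 (0 : Y), SetRel.preimage (Γ : Set (X × Y)) B ∈ 𝓝 (0 : X))
    {B : Set Y} (hB : IsOpen B) : IsOpen (SetRel.preimage (Γ : Set (X × Y)) B) := by
  rw [isOpen_iff_mem_nhds]
  rintro x ⟨b, hb, hxb⟩
  have hshift : {c : Y | c + b ∈ B} ∈ 𝓝 (0 : Y) :=
    (continuous_id.add continuous_const).continuousAt.preimage_mem_nhds
      (hB.mem_nhds (by simpa using hb))
  have hback : {z : X | z - x ∈ SetRel.preimage (Γ : Set (X × Y)) {c : Y | c + b ∈ B}} ∈ 𝓝 x :=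
    (continuous_id.sub continuous_const).continuousAt.preimage_mem_nhds
      (by simpa using hΓ _ hshift)
  refine Filter.mem_of_superset hback ?_
  rintro z ⟨c, hc, hzc⟩
  refine ⟨c + b, hc, ?_⟩
  have hsum : ((z - x, c) : X × Y) + (x, b) ∈ Γ := Γ.add_mem hzc hxb
  simpa using hsum

/-- The domain of the adjoint of a linear relation `Γ ⊆ X × Y`: the functionals `g` on `Y` for
which some functional `f` on `X` satisfies `f x = g y` for all `(x, y) ∈ Γ`. -/
def Submodule.adjointDomain (Γ : Submodule 𝕜 (X × Y)) : Submodule 𝕜 (WeakDual 𝕜 Y) where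
  carrier := {g | ∃ f : WeakDual 𝕜 X, ∀ p ∈ Γ, f p.1 = g p.2}
  zero_mem' := ⟨0, fun _ _ => rfl⟩
  add_mem' := by
    rintro g g' ⟨f, hf⟩ ⟨f', hf'⟩
    exact ⟨f + f', fun p hp => congrArg₂ (· + ·) (hf p hp) (hf' p hp)⟩
  smul_mem' := by
    rintro c g ⟨f, hf⟩
    exact ⟨c • f, fun p hp => congrArg (c • ·) (hf p hp)⟩

variable [ContinuousSMul 𝕜 Y]

open scoped Pointwise in
/-- A nearly continuous, everywhere defined linear relation `Γ` pulls neighbourhoods of zero back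
to neighbourhoods of zero, provided every functional vanishing on `Γ 0` lies in the domain of the
adjoint. -/
theorem Submodule.preimage_mem_nhds_zero [Module ℝ Y] [IsScalarTower ℝ 𝕜 Y]
    [LocallyConvexSpace ℝ Y] (Γ : Submodule 𝕜 (X × Y))
    (hdom : SetRel.dom (Γ : Set (X × Y)) = Set.univ)
    (hnear : ∀ B ∈ 𝓝 (0 : Y), closure (SetRel.preimage (Γ : Set (X × Y)) B) ∈ 𝓝 (0 : X))
    (hadj : ∀ g : WeakDual 𝕜 Y, (∀ y, ((0, y) : X × Y) ∈ Γ → g y = 0) → g ∈ Γ.adjointDomain)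
    {B : Set Y} (hB : B ∈ 𝓝 (0 : Y)) :
    SetRel.preimage (Γ : Set (X × Y)) B ∈ 𝓝 (0 : X) := by
  have := IsScalarTower.continuousSMul (M := ℝ) (α := Y) 𝕜
  obtain ⟨V, hV, hVB⟩ := exists_nhds_half_neg hB
  obtain ⟨W, ⟨hW, hWconv⟩, hWV⟩ := (LocallyConvexSpace.convex_basis_zero ℝ Y).mem_iff.1 hV
  let N : Submodule 𝕜 Y := Γ.comap (LinearMap.inr 𝕜 X Y)
  let C : Set Y := closure ((N.restrictScalars ℝ : Set Y) + W)
  have hC : Convex ℝ C := ((N.restrictScalars ℝ).convex.add hWconv).closure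
  refine Filter.mem_of_superset (hnear W hW) fun x hx => ?_
  obtain ⟨y, hxy⟩ : x ∈ SetRel.dom (Γ : Set (X × Y)) := hdom ▸ Set.mem_univ x
  have hyC : y ∈ C := by
    by_contra hyC
    obtain ⟨g, u, hg, hgy⟩ :=
      RCLike.geometric_hahn_banach_closed_point (𝕜 := 𝕜) hC isClosed_closure hyC
    have hgN : ∀ n ∈ N, RCLike.re (g n) < u := fun n hn =>
      hg n (subset_closure ⟨n, hn, 0, mem_of_mem_nhds hW, add_zero n⟩)
    obtain ⟨f, hf⟩ := hadj (StrongDual.toWeakDual g) fun n hn =>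
      N.apply_eq_zero_of_re_lt g.toLinearMap hgN hn
    have hclosed : IsClosed {x : X | RCLike.re (f x) ≤ u} :=
      isClosed_le (RCLike.continuous_re.comp (map_continuous f)) continuous_const
    have hfx : RCLike.re (f x) ≤ u := by
      refine closure_minimal ?_ hclosed hx
      rintro x' ⟨b, hb, hxb⟩
      have hfg : f x' = g b := hf _ hxb
      exact (congrArg RCLike.re hfg).trans_le
        (hg b (subset_closure ⟨0, N.zero_mem, b, hb, zero_add b⟩)).le
    have hfg : f x = g y := hf _ hxy
    exact (hgy.trans_le' (hfg ▸ hfx)).false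
  have hyW : {z : Y | z - y ∈ W} ∈ 𝓝 y :=
    (continuous_id.sub continuous_const).continuousAt.preimage_mem_nhds (by simpa using hW)
  obtain ⟨z, hz, n, hn, b, hb, rfl⟩ := mem_closure_iff_nhds.1 hyC _ hyW
  -- This witness is `y - n`, written as a difference of two elements of `W`; subtracting `(0, n)`
  -- from `(x, y)` stays in `Γ`.
  refine ⟨b - (n + b - y), hVB _ (hWV hb) _ (hWV hz), ?_⟩
  have hdiff := Γ.sub_mem hxy (show ((0, n) : X × Y) ∈ Γ from hn)
  have : ((x, b - (n + b - y)) : X × Y) = (x, y) - (0, n) := by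
    ext <;> simp
    abel
  exact this ▸ hdiff

variable [IsTopologicalAddGroup X] [ContinuousSMul 𝕜 X]

/-- For a nearly continuous linear relation, the domain of the adjoint meets every
equicontinuous polar in a weak-* closed set. -/
theorem Submodule.isClosed_adjointDomain_inter_polar (Γ : Submodule 𝕜 (X × Y)) {U : Set Y}
    (hU : U ∈ 𝓝 (0 : Y))
    (hΓU : closure (SetRel.preimage (Γ : Set (X × Y)) U) ∈ 𝓝 (0 : X)) :
    IsClosed ((Γ.adjointDomain : Set (WeakDual 𝕜 Y)) ∩ WeakDual.polar 𝕜 U) := by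
  set V := closure (SetRel.preimage (Γ : Set (X × Y)) U)
  let A : Set (WeakDual 𝕜 X × WeakDual 𝕜 Y) := ⋂ p ∈ Γ, {q | q.1 p.1 = q.2 p.2}
  have hA : IsClosed A := isClosed_biInter fun p _ =>
    isClosed_eq ((WeakDual.eval_continuous p.1).comp continuous_fst)
      ((WeakDual.eval_continuous p.2).comp continuous_snd)
  -- Requiring `f ∈ V°` loses nothing: a partner `f` of `g ∈ U°` is bounded by `1` on the preimage
  -- of `U`, hence on its closure `V`. It is what makes the set of pairs compact.
  have hcompact : IsCompact (A ∩ WeakDual.polar 𝕜 V ×ˢ WeakDual.polar 𝕜 U) :=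
    ((WeakDual.isCompact_polar_of_mem_nhds hΓU).prod
      (WeakDual.isCompact_polar_of_mem_nhds hU)).inter_left hA
  convert (hcompact.image continuous_snd).isClosed using 1
  ext g
  constructor
  · rintro ⟨⟨f, hf⟩, hg⟩
    refine ⟨(f, g), ⟨Set.mem_iInter₂.2 hf, ?_, hg⟩, rfl⟩
    have hclosed : IsClosed {x : X | ‖f x‖ ≤ 1} :=
      isClosed_le (map_continuous f).norm continuous_const
    refine fun x hx => closure_minimal ?_ hclosed hx
    rintro x ⟨b, hb, hxb⟩
    have : f x = g b := hf _ hxb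
    exact (congrArg norm this).trans_le (hg b hb)
  · rintro ⟨⟨f, g⟩, ⟨hf, -, hg⟩, rfl⟩
    exact ⟨⟨f, Set.mem_iInter₂.1 hf⟩, hg⟩

/-- A closed linear relation contains `(0, y)` as soon as the domain of its adjoint vanishes
at `y`. -/
theorem Submodule.zero_mk_mem_of_forall_adjointDomain [Module ℝ X] [IsScalarTower ℝ 𝕜 X]
    [LocallyConvexSpace ℝ X] [Module ℝ Y] [IsScalarTower ℝ 𝕜 Y] [LocallyConvexSpace ℝ Y]
    (Γ : Submodule 𝕜 (X × Y)) (hΓ : IsClosed (Γ : Set (X × Y))) {y : Y}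
    (hy : ∀ g ∈ Γ.adjointDomain, g y = 0) : ((0, y) : X × Y) ∈ Γ := by
  by_contra h
  obtain ⟨F, hF, hFy⟩ := Γ.exists_strongDual_ne_zero hΓ h
  refine hFy (hy (StrongDual.toWeakDual (F.comp (ContinuousLinearMap.inr 𝕜 X Y))) ?_)
  -- `F` vanishes on `Γ`, so its restrictions to the two factors are adjoint partners up to sign.
  refine ⟨StrongDual.toWeakDual (-F.comp (ContinuousLinearMap.inl 𝕜 X Y)), fun p hp => ?_⟩
  have hsum : F (p.1, 0) + F (0, p.2) = 0 := by
    rw [← map_add, Prod.mk_add_mk, add_zero, zero_add]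
    exact hF p hp
  exact neg_eq_of_add_eq_zero_right hsum

end LinearRelation

theorem mainTheorem4 {𝕜 X Y : Type*} [RCLike 𝕜]
    [AddCommGroup X] [Module 𝕜 X] [Module ℝ X] [IsScalarTower ℝ 𝕜 X]
    [TopologicalSpace X] [IsTopologicalAddGroup X] [ContinuousSMul 𝕜 X]
    [LocallyConvexSpace ℝ X] [T2Space X]
    [AddCommGroup Y] [Module 𝕜 Y] [Module ℝ Y] [IsScalarTower ℝ 𝕜 Y]
    [TopologicalSpace Y] [IsTopologicalAddGroup Y] [ContinuousSMul 𝕜 Y]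
    [LocallyConvexSpace ℝ Y] [T2Space Y]
    (hY : IsFullyComplete 𝕜 Y)
    (Γ : Submodule 𝕜 (X × Y)) (hΓ : IsClosed (Γ : Set (X × Y)))
    (hdom : SetRel.dom (Γ : Set (X × Y)) = Set.univ)
    (hnear : ∀ B ∈ 𝓝 (0 : Y), closure (SetRel.preimage (Γ : Set (X × Y)) B) ∈ 𝓝 (0 : X)) :
    ∀ B : Set Y, IsOpen B → IsOpen (SetRel.preimage (Γ : Set (X × Y)) B) := by
  have hD : IsClosed (Γ.adjointDomain : Set (WeakDual 𝕜 Y)) :=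
    hY.isClosed_of_inter_polar _ fun U hU =>
      Γ.isClosed_adjointDomain_inter_polar hU (hnear U hU)
  have hadj : ∀ g : WeakDual 𝕜 Y, (∀ y, ((0, y) : X × Y) ∈ Γ → g y = 0) → g ∈ Γ.adjointDomain :=
    fun g hg => WeakDual.mem_of_isClosed_of_forall_eq_zero _ hD fun y hy =>
      hg y (Γ.zero_mk_mem_of_forall_adjointDomain hΓ hy)
  exact fun B hB => Γ.isOpen_preimage
    (fun _ hU => Γ.preimage_mem_nhds_zero hdom hnear hadj hU) hB
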